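/- Let $H$ be a hyperbolic group, let $S$ be a finite generating set of $H$, let $d$ be the word metric of $S$ (the path metric of the Cayley graph $\Gamma$ of $H$ with respect to $S$), and let $\delta$ be such that $\Gamma$ is $\delta$-hyperbolic, i.e. geodesic triangles in $\Gamma$ are $\delta$-slim. Let $\partial H=\partial\Gamma$ be the Gromov boundary, and let $\rho$ be a visual metric on $\partial H$: a metric that induces the topology of $\partial H$ and for which there are $a>1$ and $C\ge 0$ such that, for every bi-infinite geodesic $\gamma$ in $\Gamma$ with endpoints $\gamma(-\infty),\gamma(\infty)\in\partial H$, $$a^{-d(e,\gamma)-C}\le \rho(\gamma(-\infty),\gamma(\infty))\le a^{-d(e,\gamma)+C}.$$ Let $Z\subseteq\partial H$ be a closed subset whose Hausdorff dimension with respect to $\rho$ is positive. Let $\mathrm{hull}_w(Z)$ be the weak convex hull of $Z$ in $\Gamma$, that is, the $4\delta$-thickening of the union of all bi-infinite geodesics of $\Gamma$ joining two distinct points of $Z$ (the largest subgraph contained in the closed $4\delta$-neighbourhood of this union). Then $\mathrm{hull}_w(Z)$ does not have polynomial growth with respect to $d$: for no $x\in H$ is there a polynomial $p$ such that, for every $n\in\mathbb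 N$, the ball of radius $n$ around $x$ in $(H,d)$ contains at most $p(n)$ vertices of $\mathrm{hull}_w(Z)$. -/

import Mathlib

noncomputable section

namespace HypGroup

variable {V : Type*}

/-- A walk in a graph is geodesic if no walk with the same endpoints is shorter. -/
def IsGeodesicWalk (G : SimpleGraph V) {x y : V} (p : G.Walk x y) : Prop :=
  p.length = G.dist x y

/-- A connected graph is `δ`-hyperbolic if geodesic triangles are `δ`-slim: every vertex on a side
of a geodesic triangle is at distance at most `δ` from a vertex on one of the other two sides.
(If the geodesic triangles of the metric realization of the graph are `δ`-slim then so are the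
triangles considered here, as a shortest path from a vertex to a geodesic edge path can be chosen
to end at a vertex.) -/
def IsHyperbolic (G : SimpleGraph V) (δ : ℝ) : Prop :=
  G.Connected ∧
    ∀ (x y z : V) (p : G.Walk x y) (q : G.Walk y z) (r : G.Walk x z),
      IsGeodesicWalk G p → IsGeodesicWalk G q → IsGeodesicWalk G r →
        ∀ v ∈ p.support, ∃ w, (w ∈ q.support ∨ w ∈ r.support) ∧ (G.dist v w : ℝ) ≤ δ

/-- Geodesic rays (parametrized by their vertices). -/
def GeodesicRay (G : SimpleGraph V) : Type _ :=
  {γ : ℕ → V // ∀ m n : ℕ, (G.dist (γ m) (γ n) : ℤ) = |(m : ℤ) - n|}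

/-- Bi-infinite geodesics (parametrized by their vertices). -/
def GeodesicLine (G : SimpleGraph V) : Type _ :=
  {γ : ℤ → V // ∀ m n : ℤ, (G.dist (γ m) (γ n) : ℤ) = |m - n|}

/-- Two geodesic rays are asymptotic if they stay at bounded distance from each other. -/
instance asymptotic (G : SimpleGraph V) : Setoid (GeodesicRay G) where
  r γ γ' := ∃ K : ℕ, ∀ n, G.edist (γ.1 n) (γ'.1 n) ≤ K
  iseqv :=
    { refl := fun γ => ⟨0, fun n => by simp⟩
      symm := by
        rintro γ γ' ⟨K, h⟩
        exact ⟨K, fun n => by rw [SimpleGraph.edist_comm]; exact h n⟩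
      trans := by
        rintro γ γ' γ'' ⟨K, h⟩ ⟨K', h'⟩
        refine ⟨K + K', fun n => (SimpleGraph.edist_triangle (v := γ'.1 n)).trans ?_⟩
        push_cast
        exact add_le_add (h n) (h' n) }

/-- The topology of uniform convergence on compact sets on the set of geodesic rays, which is
pointwise convergence for the discrete topology on vertices. -/
instance rayTopology (G : SimpleGraph V) : TopologicalSpace (GeodesicRay G) :=
  TopologicalSpace.induced Subtype.val (@Pi.topologicalSpace ℕ (fun _ => V) (fun _ => ⊥))

/-- The Gromov boundary: geodesic rays modulo being asymptotic. -/
def GromovBoundary (G : SimpleGraph V) : Type _ := Quotient (asymptotic G)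

/-- The Gromov boundary carries the quotient of the topology on geodesic rays. (For a locally
finite hyperbolic graph the boundary is the Hausdorff quotient of the compact space of
rays issuing from a given vertex, so this is the usual topology.) -/
abbrev boundaryTopology (G : SimpleGraph V) : TopologicalSpace (GromovBoundary G) :=
  @instTopologicalSpaceQuotient (GeodesicRay G) (asymptotic G) (rayTopology G)

variable {G : SimpleGraph V}

/-- The endpoint in the Gromov boundary of a geodesic ray. -/
def GeodesicRay.endpoint (γ : GeodesicRay G) : GromovBoundary G :=
  Quotient.mk (asymptotic G) γ

/-- The half `n ↦ γ(n)` of a bi-infinite geodesic. -/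
def GeodesicLine.forwardRay (γ : GeodesicLine G) : GeodesicRay G :=
  ⟨fun n => γ.1 n, fun m n => γ.2 m n⟩

/-- The half `n ↦ γ(-n)` of a bi-infinite geodesic. -/
def GeodesicLine.backwardRay (γ : GeodesicLine G) : GeodesicRay G :=
  ⟨fun n => γ.1 (-n), fun m n => by rw [γ.2, ← abs_neg]; congr 1; ring⟩

/-- The endpoint `γ(∞)`. -/
def GeodesicLine.posEnd (γ : GeodesicLine G) : GromovBoundary G := γ.forwardRay.endpoint

/-- The endpoint `γ(-∞)`. -/
def GeodesicLine.negEnd (γ : GeodesicLine G) : GromovBoundary G := γ.backwardRay.endpoint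

/-- The distance from a vertex `o` to a bi-infinite geodesic. -/
def GeodesicLine.distFrom (o : V) (γ : GeodesicLine G) : ℕ := ⨅ n : ℤ, G.dist o (γ.1 n)

/-- A metric `ρ` on the Gromov boundary is visual, with respect to the base vertex `o`, if it
induces the topology of the boundary and there are `a > 1`, `C ≥ 0` such that
`a ^ (-d(o,γ) - C) ≤ ρ(γ(-∞), γ(∞)) ≤ a ^ (-d(o,γ) + C)` for every bi-infinite geodesic `γ`. -/
def IsVisualMetric (G : SimpleGraph V) (o : V) (ρ : MetricSpace (GromovBoundary G)) : Prop :=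
  ρ.toPseudoMetricSpace.toUniformSpace.toTopologicalSpace = boundaryTopology G ∧
    ∃ a C : ℝ, 1 < a ∧ 0 ≤ C ∧ ∀ γ : GeodesicLine G,
      a ^ (-(γ.distFrom o : ℝ) - C) ≤ ρ.dist γ.negEnd γ.posEnd ∧
        ρ.dist γ.negEnd γ.posEnd ≤ a ^ (-(γ.distFrom o : ℝ) + C)

/-- The Hausdorff dimension of a set with respect to a given metric. -/
def hausdorffDim {X : Type*} (ρ : MetricSpace X) (Z : Set X) : ENNReal :=
  @dimH X (@MetricSpace.toEMetricSpace X ρ) Z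

/-- The vertex set of the weak convex hull of `U` in a `δ`-hyperbolic graph: the vertices of the
`4δ`-thickening of the union of all bi-infinite geodesics between distinct points of `U`. -/
def weakHull (G : SimpleGraph V) (δ : ℝ) (U : Set (GromovBoundary G)) : Set V :=
  {v | ∃ γ : GeodesicLine G, γ.negEnd ∈ U ∧ γ.posEnd ∈ U ∧ γ.negEnd ≠ γ.posEnd ∧
    ∃ n : ℤ, (G.dist v (γ.1 n) : ℝ) ≤ 4 * δ}

/-- A set `A` of vertices of a connected graph `G` has polynomial growth, with respect to the path
metric of `G`, if for some base vertex `x` the number of points of `A` in the ball of radius `n`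
around `x` is bounded by a polynomial in `n`. -/
def HasPolynomialGrowth (G : SimpleGraph V) (A : Set V) : Prop :=
  ∃ (x : V) (p : Polynomial ℕ), ∀ n : ℕ, (A ∩ {v | G.dist x v ≤ n}).encard ≤ (p.eval n : ℕ)

end HypGroup

end

namespace HypGroup

open Filter SimpleGraph

variable {V : Type*} {G : SimpleGraph V}

/-! The contrapositive is proved: if the weak hull has polynomial growth, `Z` has dimension zero.
Fix `ξ` in `Z`. Every other `z` in `Z` is the positive end of a line from `ξ`
(`FourPoint.exists_line`, a limit of geodesic segments). Sort these `z` by a bound `D` on the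
distance from `o` to vertex `0` of the line. For fixed `D`, group them by the `n`-th vertex of the
line: it lies in the hull, within `n` plus a constant of the base vertex, so there are polynomially
many groups. If two lines share their `n`-th vertex, a line joining their ends stays about `n` away
from `o` (`FourPoint.le_distFrom`), so visuality makes each group of diameter `O(a ^ (-n))`. Hence
each piece has dimension zero (`dimH_eq_zero_of_forall_cover`), and so has the countable union over
`D` together with `ξ`. -/

/-! ### Slim triangles and the four-point condition -/

/-- The four-point condition for the path metric of a graph. -/
def FourPoint (G : SimpleGraph V) (K : ℕ) : Prop :=
  ∀ x y z w, G.dist x z + G.dist y w ≤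
    max (G.dist x y + G.dist z w) (G.dist x w + G.dist y z) + K

/-- In a connected graph any two vertices are joined by a geodesic path, here parametrized by its
vertices. -/
lemma exists_geodesic_path (hG : G.Connected) (x y : V) :
    ∃ p : G.Walk x y, IsGeodesicWalk G p ∧ ∀ i j, i ≤ j → j ≤ G.dist x y →
      G.dist (p.getVert i) (p.getVert j) = j - i := by
  obtain ⟨p, hp⟩ := hG.exists_walk_length_eq_dist x y
  refine ⟨p, hp, fun i j hij hj => ?_⟩
  have hupper : ∀ i j, i ≤ j → j ≤ G.dist x y →
      G.dist (p.getVert i) (p.getVert j) ≤ j - i := by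
    intro i j hij hj
    have h := dist_le ((p.drop i).take (j - i))
    rw [Walk.take_length, Walk.drop_getVert] at h
    rw [show i + (j - i) = j by omega] at h
    omega
  -- The three upper bounds add up to `G.dist x y`, so the triangle inequality makes each an
  -- equality.
  have h1 := hupper 0 i (by omega) (by omega)
  have h2 := hupper i j hij hj
  have h3 := hupper j _ hj le_rfl
  rw [Walk.getVert_zero] at h1
  rw [← hp, Walk.getVert_length, hp] at h3
  have h4 := hG.dist_triangle (u := x) (v := p.getVert i) (w := y)
  have h5 := hG.dist_triangle (u := p.getVert i) (v := p.getVert j) (w := y)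
  omega

lemma IsHyperbolic.nonneg {δ : ℝ} (h : IsHyperbolic G δ) : 0 ≤ δ := by
  obtain ⟨x⟩ := h.1.nonempty
  have hn : IsGeodesicWalk G (Walk.nil : G.Walk x x) := by simp [IsGeodesicWalk]
  obtain ⟨w, -, hw⟩ := h.2 x x x .nil .nil .nil hn hn hn x (by simp)
  exact le_trans (by positivity) hw

lemma IsGeodesicWalk.dist_add_dist (hG : G.Connected) {x y v : V} {p : G.Walk x y}
    (hp : IsGeodesicWalk G p) (hv : v ∈ p.support) :
    G.dist x v + G.dist v y = G.dist x y := by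
  classical
  have h1 := dist_le (p.takeUntil v hv)
  have h2 := dist_le (p.dropUntil v hv)
  have h3 := congrArg Walk.length (p.take_spec hv)
  rw [Walk.length_append] at h3
  have h4 := hG.dist_triangle (u := x) (v := v) (w := y)
  have h5 : p.length = G.dist x y := hp
  omega

/-- A vertex of a geodesic between two vertices almost lies between one of these and a given third
vertex. -/
lemma IsHyperbolic.dist_le_or {δ : ℝ} (h : IsHyperbolic G δ) {x z v : V} {p : G.Walk x z}
    (hp : IsGeodesicWalk G p) (hv : v ∈ p.support) (y : V) :
    G.dist x v + G.dist v y ≤ G.dist x y + 2 * ⌊δ⌋₊ ∨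
      G.dist z v + G.dist v y ≤ G.dist z y + 2 * ⌊δ⌋₊ := by
  obtain ⟨q, hq⟩ := h.1.exists_walk_length_eq_dist z y
  obtain ⟨r, hr⟩ := h.1.exists_walk_length_eq_dist x y
  obtain ⟨w, hw, hvw⟩ := h.2 x z y p q r hp hq hr v hv
  have hvw' : G.dist v w ≤ ⌊δ⌋₊ := Nat.le_floor hvw
  have t3 := h.1.dist_triangle (u := v) (v := w) (w := y)
  have t4 := G.dist_comm (u := v) (v := w)
  rcases hw with hw | hw
  · have h1 := IsGeodesicWalk.dist_add_dist h.1 hq hw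
    have t1 := h.1.dist_triangle (u := z) (v := w) (w := v)
    omega
  · have h1 := IsGeodesicWalk.dist_add_dist h.1 hr hw
    have t1 := h.1.dist_triangle (u := x) (v := w) (w := v)
    omega

lemma exists_switch {P Q : ℕ → Prop} (D : ℕ) (h0 : P 0) (hD : Q D)
    (h : ∀ i ≤ D, P i ∨ Q i) : ∃ i ≤ D, P i ∧ (Q i ∨ (i + 1 ≤ D ∧ Q (i + 1))) := by
  induction D with
  | zero => exact ⟨0, le_rfl, h0, Or.inl hD⟩
  | succ D ih =>
    rcases h D (by omega) with hp | hq
    · exact ⟨D, by omega, hp, Or.inr ⟨le_rfl, hD⟩⟩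
    · obtain ⟨i, hi, hpi, hqi⟩ := ih hq fun i hi => h i (by omega)
      exact ⟨i, by omega, hpi, hqi.imp_right fun hh => ⟨by omega, hh.2⟩⟩

/-- A vertex of a geodesic from `x` to `z` that is on the `x` side for `y` and on the `z` side for
`w`, or vice versa, gives the inequality by the triangle inequality. Otherwise the side changes for
`y` and `w` simultaneously along some edge; crossing that edge costs the extra `2`. -/
lemma IsHyperbolic.fourPoint {δ : ℝ} (h : IsHyperbolic G δ) :
    FourPoint G (4 * ⌊δ⌋₊ + 2) := by
  intro x y z w
  obtain ⟨p, hp, hpd⟩ := exists_geodesic_path h.1 x z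
  have hx : p.getVert 0 = x := p.getVert_zero
  have hz : p.getVert (G.dist x z) = z := by
    rw [← show p.length = G.dist x z from hp, Walk.getVert_length]
  have hor := fun i => h.dist_le_or hp (p.getVert_mem_support i)
  have hA : ∀ i ≤ G.dist x z, G.dist x (p.getVert i) = i := by
    intro i hi
    have := hpd 0 i (by omega) hi
    rwa [hx] at this
  have hB : ∀ i ≤ G.dist x z, G.dist z (p.getVert i) = G.dist x z - i := by
    intro i hi
    have := hpd i _ hi le_rfl
    rwa [hz, dist_comm] at this
  have tri := fun i => h.1.dist_triangle (u := y) (v := p.getVert i) (w := w)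
  have c1 := fun i => G.dist_comm (u := y) (v := p.getVert i)
  have cyz := G.dist_comm (u := y) (v := z)
  by_contra hcon
  have key : ∀ i ≤ G.dist x z,
      (G.dist x (p.getVert i) + G.dist (p.getVert i) y ≤ G.dist x y + 2 * ⌊δ⌋₊ ∧
        G.dist x (p.getVert i) + G.dist (p.getVert i) w ≤ G.dist x w + 2 * ⌊δ⌋₊) ∨
      (G.dist z (p.getVert i) + G.dist (p.getVert i) y ≤ G.dist z y + 2 * ⌊δ⌋₊ ∧
        G.dist z (p.getVert i) + G.dist (p.getVert i) w ≤ G.dist z w + 2 * ⌊δ⌋₊) := by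
    intro i hi
    have := hor i y
    have := hor i w
    have := hA i hi
    have := hB i hi
    have := tri i
    have := c1 i
    omega
  obtain ⟨i, hi, hPi, hQ⟩ := exists_switch _ (by rw [hx]; simp) (by rw [hz]; simp) key
  have a1 := hA i hi
  have b1 := hB i hi
  have t1 := tri i
  have c1i := c1 i
  rcases hQ with hQ | ⟨hi', hQ⟩
  · omega
  · have e := hpd i (i + 1) (by omega) hi'
    have b2 := hB _ hi'
    have t2 := h.1.dist_triangle (u := p.getVert i) (v := p.getVert (i + 1)) (w := w)
    omega

/-! ### Boundary points and the lines joining them -/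

lemma GeodesicRay.dist_eq (γ : GeodesicRay G) {m n : ℕ} (h : m ≤ n) :
    G.dist (γ.1 m) (γ.1 n) = n - m := by
  have := γ.2 m n
  rw [Int.abs_eq_natAbs] at this
  omega

lemma GeodesicLine.dist_eq (γ : GeodesicLine G) (m n : ℤ) :
    G.dist (γ.1 m) (γ.1 n) = (m - n).natAbs := by
  have := γ.2 m n
  rw [Int.abs_eq_natAbs] at this
  exact_mod_cast this

lemma endpoint_eq_iff (hG : G.Connected) {α β : GeodesicRay G} :
    α.endpoint = β.endpoint ↔ ∃ K : ℕ, ∀ n, G.dist (α.1 n) (β.1 n) ≤ K := by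
  refine Quotient.eq.trans (exists_congr fun K => forall_congr' fun n => ?_)
  rw [← (hG (α.1 n) (β.1 n)).coe_dist_eq_edist]
  exact Nat.cast_le

/-- Rays with different endpoints have bounded Gromov product. -/
lemma FourPoint.exists_dist_add_le {K : ℕ} (hK : FourPoint G K) (hG : G.Connected)
    {α β : GeodesicRay G} (hne : α.endpoint ≠ β.endpoint) :
    ∃ M : ℕ, ∀ i j, G.dist (α.1 i) (α.1 0) + G.dist (β.1 j) (α.1 0) ≤
      G.dist (α.1 i) (β.1 j) + M := by
  by_contra! hcon
  refine hne ((endpoint_eq_iff hG).2 ⟨3 * G.dist (α.1 0) (β.1 0) + 2 * K, fun n => ?_⟩)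
  -- So large a Gromov product forces `n ≤ i` and `n ≤ j`, and decides which term is the maximum in
  -- `f1`.
  obtain ⟨i, j, hij⟩ := hcon (2 * n + 2 * G.dist (α.1 0) (β.1 0) + K)
  have a1 := α.dist_eq (Nat.zero_le i)
  have a2 := α.dist_eq (Nat.zero_le n)
  have b1 := β.dist_eq (Nat.zero_le j)
  have b2 := β.dist_eq (Nat.zero_le n)
  have t1 := hG.dist_triangle (u := β.1 j) (v := β.1 0) (w := α.1 0)
  have t2 := hG.dist_triangle (u := β.1 0) (v := α.1 0) (w := β.1 j)
  have t3 := hG.dist_triangle (u := α.1 0) (v := β.1 0) (w := β.1 n)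
  have t4 := hG.dist_triangle (u := α.1 0) (v := α.1 i) (w := β.1 j)
  have t5 := hG.dist_triangle (u := α.1 i) (v := β.1 j) (w := α.1 0)
  have c1 := G.dist_comm (u := α.1 0) (v := β.1 0)
  have c2 := G.dist_comm (u := α.1 0) (v := β.1 j)
  have c3 := G.dist_comm (u := β.1 0) (v := β.1 j)
  have c4 := G.dist_comm (u := α.1 0) (v := α.1 i)
  have c5 := G.dist_comm (u := β.1 j) (v := α.1 i)
  have c6 := G.dist_comm (u := β.1 j) (v := β.1 n)
  have hi : n ≤ i := by omega
  have hj : n ≤ j := by omega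
  have a3 := α.dist_eq hi
  have b3 := β.dist_eq hj
  have f1 := hK (α.1 n) (α.1 i) (β.1 j) (α.1 0)
  have f2 := hK (α.1 n) (β.1 j) (β.1 n) (α.1 0)
  have c7 := G.dist_comm (u := α.1 0) (v := α.1 n)
  have c8 := G.dist_comm (u := α.1 0) (v := β.1 n)
  omega

/-- A vertex that looks from `o` and from a far point of a ray like the `n`-th vertex of the ray is
close to that vertex. -/
lemma FourPoint.dist_ray_le {K : ℕ} (hK : FourPoint G K) (hG : G.Connected) (β : GeodesicRay G)
    {o x : V} {n i R : ℕ} (hi : n ≤ i) (h1 : G.dist o x ≤ n + R)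
    (h2 : G.dist x (β.1 i) + n ≤ i + R) :
    G.dist x (β.1 n) ≤ 2 * G.dist o (β.1 0) + R + K := by
  have f := hK x (β.1 i) (β.1 n) o
  have b1 := β.dist_eq hi
  have b2 := β.dist_eq (Nat.zero_le n)
  have b3 := β.dist_eq (Nat.zero_le i)
  have t1 := hG.dist_triangle (u := β.1 0) (v := o) (w := β.1 i)
  have t2 := hG.dist_triangle (u := o) (v := β.1 0) (w := β.1 n)
  have c1 := G.dist_comm (u := o) (v := β.1 0)
  have c2 := G.dist_comm (u := o) (v := β.1 i)
  have c3 := G.dist_comm (u := o) (v := β.1 n)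
  have c4 := G.dist_comm (u := o) (v := x)
  have c5 := G.dist_comm (u := β.1 i) (v := β.1 n)
  omega

/-- Segments between points of rays with different endpoints pass near a given vertex. -/
lemma FourPoint.exists_segments {K : ℕ} (hK : FourPoint G K) (hG : G.Connected)
    {α β : GeodesicRay G} (hne : α.endpoint ≠ β.endpoint) :
    ∃ R : ℕ, ∀ i : ℕ, ∃ c : ℤ → V, G.dist (α.1 0) (c 0) ≤ R ∧
      (∀ m : ℤ, m.natAbs + R ≤ i → G.dist (c m) (α.1 i) ≤ i + m + R ∧
        G.dist (c m) (β.1 i) ≤ i - m + R) ∧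
      ∀ m n : ℤ, m.natAbs + R ≤ i → n.natAbs + R ≤ i → G.dist (c m) (c n) = (m - n).natAbs := by
  obtain ⟨M, hM⟩ := hK.exists_dist_add_le hG hne
  refine ⟨2 * M + K + G.dist (α.1 0) (β.1 0), fun i => ?_⟩
  obtain ⟨p, hp, hpd⟩ := exists_geodesic_path hG (α.1 i) (β.1 i)
  have hx : p.getVert 0 = α.1 i := p.getVert_zero
  have hz : p.getVert (G.dist (α.1 i) (β.1 i)) = β.1 i := by
    rw [← show p.length = _ from hp, Walk.getVert_length]
  set D := G.dist (α.1 i) (β.1 i) with hD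
  have hMi := hM i i
  have a1 := α.dist_eq (Nat.zero_le i)
  have b1 := β.dist_eq (Nat.zero_le i)
  have c1 := G.dist_comm (u := α.1 0) (v := α.1 i)
  have c2 := G.dist_comm (u := α.1 0) (v := β.1 i)
  have c3 := G.dist_comm (u := α.1 0) (v := β.1 0)
  have t1 := hG.dist_triangle (u := β.1 0) (v := α.1 0) (w := β.1 i)
  have t2 := hG.dist_triangle (u := α.1 0) (v := β.1 0) (w := β.1 i)
  have t3 := hG.dist_triangle (u := α.1 i) (v := α.1 0) (w := β.1 i)
  have hA : ∀ t ≤ D, G.dist (p.getVert t) (α.1 i) = t := by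
    intro t ht
    have := hpd 0 t (by omega) ht
    rwa [hx, G.dist_comm] at this
  have hB : ∀ t ≤ D, G.dist (p.getVert t) (β.1 i) = D - t := by
    intro t ht
    have := hpd t D ht le_rfl
    rwa [hz] at this
  -- Index `0` is at distance `i` from `α.1 i`, just as `α.1 0` is. Once `R ≤ i`, also `i ≤ D`; the
  -- minimum only serves small `i`.
  refine ⟨fun m => p.getVert ((min i D : ℕ) + m).toNat, ?_, ?_, ?_⟩
  · simp only [add_zero, Int.toNat_natCast]
    have f := hK (α.1 i) (α.1 0) (β.1 i) (p.getVert (min i D))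
    have a2 := hA (min i D) (by omega)
    have b2 := hB (min i D) (by omega)
    have c4 := G.dist_comm (u := p.getVert (min i D)) (v := β.1 i)
    have c5 := G.dist_comm (u := p.getVert (min i D)) (v := α.1 i)
    omega
  · intro m hm
    have a2 := hA ((min i D : ℕ) + m).toNat (by omega)
    have b2 := hB ((min i D : ℕ) + m).toNat (by omega)
    beta_reduce
    omega
  · intro m n hm hn
    beta_reduce
    rcases le_total m n with h | h
    · have := hpd ((min i D : ℕ) + m).toNat ((min i D : ℕ) + n).toNat (by omega) (by omega)
      omega
    · have := hpd ((min i D : ℕ) + n).toNat ((min i D : ℕ) + m).toNat (by omega) (by omega)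
      rw [G.dist_comm] at this
      omega

/-- In a locally finite graph with the four-point condition, different points of the boundary are
joined by a bi-infinite geodesic. -/
theorem FourPoint.exists_line {K : ℕ} (hK : FourPoint G K) (hG : G.Connected)
    (hfin : ∀ (x : V) (n : ℕ), {v | G.dist x v ≤ n}.Finite)
    {ξ ζ : GromovBoundary G} (hne : ξ ≠ ζ) :
    ∃ γ : GeodesicLine G, γ.negEnd = ξ ∧ γ.posEnd = ζ := by
  obtain ⟨α, rfl⟩ : ∃ α : GeodesicRay G, α.endpoint = ξ := Quotient.exists_rep ξ
  obtain ⟨β, rfl⟩ : ∃ β : GeodesicRay G, β.endpoint = ζ := Quotient.exists_rep ζ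
  obtain ⟨R, hR⟩ := hK.exists_segments hG hne
  choose c hc0 hcab hcd using hR
  have hlarge : ∀ m : ℤ, ∀ᶠ i in (hyperfilter ℕ : Filter ℕ), m.natAbs + R ≤ i := by
    intro m
    refine Nat.hyperfilter_le_atTop ?_
    filter_upwards [eventually_ge_atTop (m.natAbs + R)] with i hi
    omega
  have hbd : ∀ m : ℤ, ∀ᶠ i in (hyperfilter ℕ : Filter ℕ),
      G.dist (α.1 0) (c i m) ≤ R + m.natAbs := by
    intro m
    filter_upwards [hlarge m, hlarge 0] with i hi hi0
    have h1 := hcd i 0 m hi0 hi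
    have h2 := hc0 i
    have h3 := hG.dist_triangle (u := α.1 0) (v := c i 0) (w := c i m)
    omega
  -- Each `c i m` eventually stays in a finite ball, so it is constant along the ultrafilter; this
  -- replaces a diagonal argument.
  have hlim : ∀ m : ℤ, ∃ v, ∀ᶠ i in (hyperfilter ℕ : Filter ℕ), c i m = v := by
    intro m
    have : ∀ᶠ i in (hyperfilter ℕ : Filter ℕ),
        ∃ v ∈ {v | G.dist (α.1 0) v ≤ R + m.natAbs}, c i m = v := by
      filter_upwards [hbd m] with i hi
      exact ⟨_, hi, rfl⟩
    obtain ⟨v, -, hv⟩ := (Ultrafilter.eventually_exists_mem_iff (hfin _ _)).1 this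
    exact ⟨v, hv⟩
  choose g hg using hlim
  have hgd : ∀ m n : ℤ, (G.dist (g m) (g n) : ℤ) = |m - n| := by
    intro m n
    rw [Int.abs_eq_natAbs, Nat.cast_inj]
    obtain ⟨i, h1, h2, h3, h4⟩ :=
      ((hg m).and ((hg n).and ((hlarge m).and (hlarge n)))).exists
    rw [← h1, ← h2]
    exact hcd i m n h3 h4
  have hnear : ∀ m : ℤ, G.dist (α.1 0) (g m) ≤ R + m.natAbs ∧ ∃ i : ℕ, m.natAbs + R ≤ i ∧
      G.dist (g m) (α.1 i) ≤ i + m + R ∧ G.dist (g m) (β.1 i) ≤ i - m + R := by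
    intro m
    obtain ⟨i, h1, h2, h3⟩ := ((hg m).and ((hlarge m).and (hbd m))).exists
    rw [← h1]
    exact ⟨h3, i, h2, hcab i m h2⟩
  refine ⟨⟨g, hgd⟩, (endpoint_eq_iff hG).2 ⟨2 * G.dist (α.1 0) (α.1 0) + R + K, fun n => ?_⟩,
    (endpoint_eq_iff hG).2 ⟨2 * G.dist (α.1 0) (β.1 0) + R + K, fun n => ?_⟩⟩
  · obtain ⟨h1, i, hi, h2, -⟩ := hnear (-n)
    exact hK.dist_ray_le hG α (o := α.1 0) (x := g (-n)) (i := i) (by omega) (by omega) (by omega)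
  · obtain ⟨h1, i, hi, -, h2⟩ := hnear n
    exact hK.dist_ray_le hG β (o := α.1 0) (x := g n) (i := i) (by omega) (by omega) (by omega)

/-! ### Lines sharing a vertex -/

lemma GeodesicLine.exists_dist_eq_distFrom (o : V) (γ : GeodesicLine G) :
    ∃ n : ℤ, G.dist o (γ.1 n) = γ.distFrom o :=
  ciInf_mem fun n : ℤ => G.dist o (γ.1 n)

/-- If two lines issue from near `o` and share their `n`-th vertex, then every line joining their
positive endpoints stays away from `o`. -/
lemma FourPoint.le_distFrom {K : ℕ} (hK : FourPoint G K) (hG : G.Connected) {o : V}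
    {γ γ' η : GeodesicLine G} {n D : ℕ} (h : γ.1 n = γ'.1 n) (hγ : G.dist o (γ.1 0) ≤ D)
    (hγ' : G.dist o (γ'.1 0) ≤ D) (hη : η.negEnd = γ.posEnd) (hη' : η.posEnd = γ'.posEnd) :
    n ≤ η.distFrom o + D + 2 * K := by
  obtain ⟨m, hm⟩ := η.exists_dist_eq_distFrom o
  rw [← hm]
  obtain ⟨A, hA⟩ := (endpoint_eq_iff hG).1 hη
  obtain ⟨B, hB⟩ := (endpoint_eq_iff hG).1 hη'
  -- `t` is so large that `m` lies between `-t` and `t` and that the bounded errors `A` and `B` drop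
  -- out of the four-point inequalities.
  obtain ⟨t, ht⟩ : ∃ t : ℕ, t = n + A + B + 2 * D + m.natAbs + 2 * K := ⟨_, rfl⟩
  replace hA : G.dist (η.1 (-t)) (γ.1 t) ≤ A := hA t
  replace hB : G.dist (η.1 t) (γ'.1 t) ≤ B := hB t
  have l1 : G.dist (η.1 (-t)) (η.1 m) + G.dist (η.1 m) (η.1 t) = 2 * t := by
    rw [η.dist_eq, η.dist_eq]
    omega
  have l2 : G.dist (η.1 (-t)) (η.1 t) = 2 * t := by
    rw [η.dist_eq]
    omega
  have l3 : G.dist (γ.1 0) (γ.1 t) = t := by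
    rw [γ.dist_eq]
    omega
  have l4 : G.dist (γ'.1 0) (γ'.1 t) = t := by
    rw [γ'.dist_eq]
    omega
  have l5 : G.dist (γ.1 t) (γ.1 n) = t - n := by
    rw [γ.dist_eq]
    omega
  have l6 : G.dist (γ.1 n) (γ'.1 t) = t - n := by
    rw [h, γ'.dist_eq]
    omega
  have l7 : G.dist (γ.1 0) (γ.1 n) = n := by
    rw [γ.dist_eq]
    omega
  generalize η.1 (-t) = P' at *
  generalize η.1 t = Q' at *
  generalize η.1 m = x at *
  generalize γ.1 t = P at *
  generalize γ'.1 t = Q at *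
  generalize γ.1 n = v at *
  generalize γ.1 0 = a at *
  generalize γ'.1 0 = b at *
  rw [G.dist_comm] at hγ hγ'
  have rv : n ≤ G.dist v o + D := by
    have := hG.dist_triangle (u := a) (v := o) (w := v)
    rw [G.dist_comm (u := o)] at this
    omega
  have rP : t ≤ G.dist P o + D := by
    have := hG.dist_triangle (u := a) (v := o) (w := P)
    rw [G.dist_comm (u := o)] at this
    omega
  have rQ : t ≤ G.dist Q o + D := by
    have := hG.dist_triangle (u := b) (v := o) (w := Q)
    rw [G.dist_comm (u := o)] at this
    omega
  have rP' : t ≤ G.dist P' o + A + D := by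
    have := hG.dist_triangle (u := P) (v := P') (w := o)
    rw [G.dist_comm (u := P) (v := P')] at this
    omega
  have rQ' : t ≤ G.dist Q' o + B + D := by
    have := hG.dist_triangle (u := Q) (v := Q') (w := o)
    rw [G.dist_comm (u := Q) (v := Q')] at this
    omega
  -- Twice the Gromov product of `P` and `Q` at `o` is at least `2 * n - 2 * D - K`, because of `v`;
  -- replacing `P` by `P'` and `Q` by `Q'` costs another `K` each.
  have s1 : G.dist P Q + 2 * n ≤ G.dist P o + G.dist Q o + 2 * D + K := by
    rcases max_choice (G.dist P v + G.dist Q o) (G.dist P o + G.dist v Q) with hmax | hmax <;>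
    · have := hK P v Q o
      rw [hmax] at this
      omega
  have s2 : G.dist P' Q + 2 * n ≤ G.dist P' o + G.dist Q o + 2 * D + 2 * K := by
    rcases max_choice (G.dist P' P + G.dist Q o) (G.dist P' o + G.dist P Q) with hmax | hmax <;>
    · have := hK P' P Q o
      rw [hmax] at this
      omega
  have s3 : G.dist P' Q' + 2 * n ≤ G.dist P' o + G.dist Q' o + 2 * D + 3 * K := by
    have c := G.dist_comm (u := Q) (v := Q')
    rcases max_choice (G.dist P' Q + G.dist Q' o) (G.dist P' o + G.dist Q Q') with hmax | hmax <;>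
    · have := hK P' Q Q' o
      rw [hmax] at this
      omega
  -- As `x` lies on a geodesic from `P'` to `Q'`, their Gromov product at `o` is at most the
  -- distance from `o` to `x`.
  have t1 := hG.dist_triangle (u := P') (v := x) (w := o)
  have t2 := hG.dist_triangle (u := Q') (v := x) (w := o)
  rw [G.dist_comm (u := Q') (v := x), G.dist_comm (u := x) (v := o)] at t2
  rw [G.dist_comm (u := x) (v := o)] at t1
  omega

/-! ### Polynomial covers and Hausdorff dimension -/

lemma tendsto_polynomial_eval_mul_pow (p : Polynomial ℕ) {r : ℝ} (h0 : 0 ≤ r) (h1 : r < 1) :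
    Tendsto (fun n : ℕ => ((p.eval n : ℕ) : ℝ) * r ^ n) atTop (nhds 0) := by
  induction p using Polynomial.induction_on' with
  | add p q hp hq => simpa [add_mul] using hp.add hq
  | monomial k c =>
    have := (tendsto_pow_const_mul_const_pow_of_lt_one k h0 h1).const_mul (c : ℝ)
    simpa [mul_assoc] using this

/-- A set that for all `n` is covered by polynomially many sets of exponentially small diameter has
Hausdorff dimension zero. -/
lemma dimH_eq_zero_of_forall_cover {X ι : Type*} [MetricSpace X] {Z : Set X} {p : Polynomial ℕ}
    {r B : ℝ} (hr0 : 0 ≤ r) (hr1 : r < 1) (hB : 0 ≤ B) (t : ℕ → ι → Set X)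
    (h : ∀ n : ℕ, ∃ A : Finset ι, A.card ≤ p.eval n ∧ (∀ z ∈ Z, ∃ i ∈ A, z ∈ t n i) ∧
      ∀ i ∈ A, ∀ x ∈ t n i, ∀ y ∈ t n i, dist x y ≤ B * r ^ n) :
    dimH Z = 0 := by
  borelize X
  choose A hcard hcov hdiam using h
  refine le_antisymm (dimH_le fun s hs => ?_) zero_le
  by_contra hs0
  have hs0 : 0 < (s : ℝ) := by simpa [pos_iff_ne_zero] using hs0
  have hrs : r ^ (s : ℝ) < 1 := Real.rpow_lt_one hr0 hr1 hs0
  have hediam : ∀ n, ∀ i ∈ A n, Metric.ediam (t n i) ≤ ENNReal.ofReal (B * r ^ n) :=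
    fun n i hi => Metric.ediam_le fun x hx y hy => by
      rw [edist_dist]
      exact ENNReal.ofReal_le_ofReal (hdiam n i hi x hx y hy)
  have hlim : Tendsto (fun n : ℕ => ENNReal.ofReal (B * r ^ n)) atTop (nhds 0) := by
    simpa using ENNReal.tendsto_ofReal
      ((tendsto_pow_atTop_nhds_zero_of_lt_one hr0 hr1).const_mul B)
  -- The sums are at most `p(n) * (B * r ^ n) ^ s`, which tends to `0`, while the measure is
  -- infinite by assumption.
  have hle := MeasureTheory.Measure.hausdorffMeasure_le_liminf_sum (s : ℝ) Z
    (l := atTop) (ι := fun n => A n) _ hlim (fun n i => t n i)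
    (Eventually.of_forall fun n i => hediam n i i.2)
    (Eventually.of_forall fun n z hz => by
      obtain ⟨i, hi, hzi⟩ := hcov n z hz
      exact Set.mem_iUnion.2 ⟨⟨i, hi⟩, hzi⟩)
  have hsum : ∀ n : ℕ, ∑ i : A n, Metric.ediam (t n i) ^ (s : ℝ) ≤
      ENNReal.ofReal (B ^ (s : ℝ) * (((p.eval n : ℕ) : ℝ) * (r ^ (s : ℝ)) ^ n)) := by
    intro n
    calc ∑ i : A n, Metric.ediam (t n i) ^ (s : ℝ)
        ≤ ∑ _i : A n, ENNReal.ofReal ((B * r ^ n) ^ (s : ℝ)) := by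
          refine Finset.sum_le_sum fun i _ => ?_
          rw [← ENNReal.ofReal_rpow_of_nonneg (by positivity) hs0.le]
          exact ENNReal.rpow_le_rpow (hediam n i i.2) hs0.le
      _ = ENNReal.ofReal ((A n).card * (B * r ^ n) ^ (s : ℝ)) := by
          rw [ENNReal.ofReal_mul (by positivity)]
          simp
      _ ≤ _ := by
          refine ENNReal.ofReal_le_ofReal ?_
          rw [Real.mul_rpow hB (by positivity), ← Real.rpow_natCast_mul hr0,
            mul_comm (n : ℝ), Real.rpow_mul_natCast hr0, mul_left_comm]
          have : ((A n).card : ℝ) ≤ (p.eval n : ℕ) := by exact_mod_cast hcard n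
          gcongr
  have h0 : Tendsto (fun n : ℕ =>
      ENNReal.ofReal (B ^ (s : ℝ) * (((p.eval n : ℕ) : ℝ) * (r ^ (s : ℝ)) ^ n))) atTop (nhds 0) := by
    simpa using ENNReal.tendsto_ofReal
      ((tendsto_polynomial_eval_mul_pow p (by positivity) hrs).const_mul (B ^ (s : ℝ)))
  have hz := tendsto_of_tendsto_of_tendsto_of_le_of_le tendsto_const_nhds h0
    (fun _ => zero_le) hsum
  rw [hz.liminf_eq, hs] at hle
  exact absurd hle (by simp)

/-! ### Dimension of the limit set -/

/-- A set of boundary points with weak hull of polynomial growth has dimension zero. -/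
theorem hausdorffDim_eq_zero {δ : ℝ} (hδ : IsHyperbolic G δ)
    (hfin : ∀ (x : V) (n : ℕ), {v | G.dist x v ≤ n}.Finite) {o : V}
    {ρ : MetricSpace (GromovBoundary G)} (hρ : IsVisualMetric G o ρ)
    {Z : Set (GromovBoundary G)} (hZ : HasPolynomialGrowth G (weakHull G δ Z)) :
    hausdorffDim ρ Z = 0 := by
  have hG := hδ.1
  have hK := hδ.fourPoint
  set K := 4 * ⌊δ⌋₊ + 2
  obtain ⟨-, a, C, ha, -, hvis⟩ := hρ
  obtain ⟨x, p, hp⟩ := hZ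
  change dimH Z = 0
  have ha0 : 0 < a := by positivity
  rcases Z.eq_empty_or_nonempty with rfl | ⟨ξ, hξ⟩
  · exact dimH_empty
  -- Away from `ξ`, the points of `Z` are reached by lines from `ξ` that pass near `o`.
  let T : ℕ → Set (GromovBoundary G) := fun D => {z | ∃ γ : GeodesicLine G,
    γ.negEnd = ξ ∧ γ.posEnd = z ∧ z ≠ ξ ∧ z ∈ Z ∧ G.dist o (γ.1 0) ≤ D}
  have hcover : Z ⊆ {ξ} ∪ ⋃ D, T D := by
    intro z hz
    rcases eq_or_ne z ξ with rfl | hne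
    · exact Or.inl rfl
    obtain ⟨γ, hγ, hγ'⟩ := hK.exists_line hG hfin hne.symm
    exact Or.inr (Set.mem_iUnion.2 ⟨G.dist o (γ.1 0), γ, hγ, hγ', hne, hz, le_rfl⟩)
  refine le_antisymm ((dimH_mono hcover).trans ?_) zero_le
  rw [dimH_union, dimH_singleton, dimH_iUnion]
  refine max_le le_rfl (iSup_le fun D => le_of_eq ?_)
  -- `B` combines the loss `D + 2 * K` in `FourPoint.le_distFrom` with the visual constant `C`; it
  -- depends on `D`, hence the splitting. The shift in `p` moves the centre from `γ.1 0` to `x`.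
  refine dimH_eq_zero_of_forall_cover (r := a⁻¹) (B := a ^ ((D : ℝ) + 2 * K + C))
    (p := p.comp (.X + .C (D + G.dist x o))) (by positivity) (inv_lt_one_of_one_lt₀ ha)
    (by positivity)
    (fun (n : ℕ) (v : V) => {z | ∃ γ : GeodesicLine G, γ.posEnd = z ∧
      G.dist o (γ.1 0) ≤ D ∧ γ.1 n = v}) fun n => ?_
  have hAfin := (hfin x (n + (D + G.dist x o))).inter_of_right (weakHull G δ Z)
  refine ⟨hAfin.toFinset, ?_, ?_, ?_⟩
  · have := hp (n + (D + G.dist x o))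
    rw [hAfin.encard_eq_coe_toFinset_card] at this
    simpa using this
  · rintro z ⟨γ, hγ, hγ', hne, hz, hD⟩
    refine ⟨γ.1 n, ?_, γ, hγ', hD, rfl⟩
    rw [Set.Finite.mem_toFinset]
    refine ⟨⟨γ, hγ ▸ hξ, hγ' ▸ hz, by rw [hγ, hγ']; exact hne.symm, n, ?_⟩, ?_⟩
    · simpa using hδ.nonneg
    · have t1 := hG.dist_triangle (u := x) (v := o) (w := γ.1 n)
      have t2 := hG.dist_triangle (u := o) (v := γ.1 0) (w := γ.1 n)
      have t3 := γ.dist_eq 0 n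
      simp only [Set.mem_ofPred_eq]
      omega
  · rintro v - z ⟨γ, rfl, hD, hv⟩ z' ⟨γ', rfl, hD', hv'⟩
    rcases eq_or_ne γ.posEnd γ'.posEnd with heq | hne
    · rw [heq, _root_.dist_self]
      positivity
    obtain ⟨η, hη, hη'⟩ := hK.exists_line hG hfin hne
    have hn := hK.le_distFrom hG (hv.trans hv'.symm) hD hD' hη hη'
    have hn' : (n : ℝ) ≤ η.distFrom o + D + 2 * K := by exact_mod_cast hn
    rw [← hη, ← hη']
    refine (hvis η).2.trans ?_
    rw [inv_pow, ← Real.rpow_natCast, ← Real.rpow_neg ha0.le, ← Real.rpow_add ha0]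
    exact Real.rpow_le_rpow_of_exponent_le ha.le (by linarith)

/-! ### Local finiteness of Cayley graphs -/

lemma finite_setOf_dist_le (hG : G.Connected) (h : ∀ x, (G.neighborSet x).Finite) (x : V)
    (n : ℕ) : {v | G.dist x v ≤ n}.Finite := by
  induction n with
  | zero =>
    refine (Set.finite_singleton x).subset fun v hv => ?_
    exact (hG.dist_eq_zero_iff.1 (Nat.le_zero.1 hv)).symm
  | succ n ih =>
    refine (ih.union (ih.biUnion fun u _ => h u)).subset fun v hv => ?_
    simp only [Set.mem_ofPred_eq] at hv
    rcases Nat.lt_or_ge n (G.dist x v) with hlt | hle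
    · obtain ⟨p, hp, hpd⟩ := exists_geodesic_path hG x v
      have h1 := hpd 0 n (by omega) (by omega)
      have h2 := hpd n (G.dist x v) (by omega) le_rfl
      rw [p.getVert_zero] at h1
      rw [← show p.length = G.dist x v from hp, p.getVert_length, hp] at h2
      -- A vertex at distance `n + 1` is adjacent to the `n`-th vertex of a geodesic leading to it.
      refine Or.inr (Set.mem_biUnion (x := p.getVert n) ?_ ?_)
      · change G.dist x (p.getVert n) ≤ n
        omega
      · exact dist_eq_one_iff_adj.1 (by omega)
    · exact Or.inl hle

lemma finite_neighborSet_mulCayley {H : Type*} [Group H] {S : Set H} (hS : S.Finite) (x : H) :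
    ((mulCayley S).neighborSet x).Finite := by
  refine ((hS.image (x * ·)).union (hS.image (x * ·⁻¹))).subset fun y hy => ?_
  obtain ⟨-, g, hg, h | h⟩ := (mulCayley_adj' S x y).1 hy
  · exact Or.inl ⟨g, hg, h⟩
  · exact Or.inr ⟨g, hg, by simp [h]⟩

end HypGroup

theorem mainTheorem6 {H : Type*} [Group H] (S : Set H) (hfin : S.Finite)
    (hgen : Subgroup.closure S = ⊤) (δ : ℝ)
    (hδ : HypGroup.IsHyperbolic (SimpleGraph.mulCayley S) δ)
    (ρ : MetricSpace (HypGroup.GromovBoundary (SimpleGraph.mulCayley S)))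
    (hρ : HypGroup.IsVisualMetric (SimpleGraph.mulCayley S) 1 ρ)
    (Z : Set (HypGroup.GromovBoundary (SimpleGraph.mulCayley S)))
    (hZ : @IsClosed _ (HypGroup.boundaryTopology (SimpleGraph.mulCayley S)) Z)
    (hdim : 0 < HypGroup.hausdorffDim ρ Z) :
    ¬ HypGroup.HasPolynomialGrowth (SimpleGraph.mulCayley S)
      (HypGroup.weakHull (SimpleGraph.mulCayley S) δ Z) := by
  exact fun hpoly => hdim.ne' (HypGroup.hausdorffDim_eq_zero hδ
    (HypGroup.finite_setOf_dist_le hδ.1 (HypGroup.finite_neighborSet_mulCayley hfin)) hρ hpoly)
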